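/- Let $m\ge 1$, let $p_1,\dots,p_m$ be primes, let $n_i,k_i$ be integers with $1\le k_i<n_i$ for all $i\in[m]=\{1,\dots,m\}$, and let $V$ be a finite set. Let $G=\mathbb{Z}_{p_1}^{n_1}\times\cdots\times\mathbb{Z}_{p_m}^{n_m}$, and let $\mathcal{H}$ be the set of all subgroups of $G$ of the form $H=H_1\times\cdots\times H_m$ with $H_i\le\mathbb{Z}_{p_i}^{n_i}$ of rank $k_i$ (the rank is the least cardinality of a generating set). A function $f:G\to V$ hides $H$ if for all $x,y\in G$: $f(x)=f(x+y)$ if and only if $y\in H$. In the restricted Abelian hidden subgroup problem, a (possibly randomized) classical algorithm receives $T$ examples $(x_1,f(x_1)),\dots,(x_T,f(x_T))$ with $x_1,\dots,x_T$ independent and uniform in $G$, where the unknown $f:G\to V$ hides some $H\in\mathcal{H}$, and has to output $H$. Its sample complexity with error $\delta$ is the least $T$ for which some algorithm outputs $H$ with probability at least $1-\delta$, for every $H\in\mathcal{H}$ and every $f$ that hides $H$ (and is $\infty$ if there is no such $T$). Put $N=\prod_{j=1}^m p_j^{n_j-k_j}=|G|/|H|$. (1) There is an absolute constant $c>0$ such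 that for every $\delta\in[0,1/2)$, and all data as above with $|V|\ge N$ (that is, such that functions that hide a candidate exist), the sample complexity is at least $$c\,\max\Bigl\{\min_{i\in[m]}k_i,\ \min_{i\in[m]}\sqrt{k_iN}\Bigr\}.$$ (2) For every $\delta\in(0,1/2)$ and every integer $\mu$ there is a constant $C=C(\delta,\mu)>0$ such that for all data as above in which no prime occurs more than $\mu$ times in the list $p_1,\dots,p_m$, the sample complexity is at most $$C\,\max_{i\in[m]}\max\bigl\{k_i,\ \sqrt{k_iN}\bigr\}.$$ In particular, if the primes $p_1,\dots,p_m$ are pairwise distinct, the constant depends on $\delta$ only. -/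

import Mathlib

open scoped ENNReal

noncomputable section

namespace HiddenSubgroup

/-- The promise of the hidden subgroup problem: `f` takes equal values at `x` and `x + y`
exactly when `y` lies in `H`. -/
def Hides {G V : Type*} [AddGroup G] (f : G → V) (H : AddSubgroup G) : Prop :=
  ∀ x y : G, f x = f (x + y) ↔ y ∈ H

/-- A classical (possibly randomized) sample algorithm that receives `T` labelled examples
`(x, f x)` and outputs a subgroup. No restriction is put on its computational power. -/
abbrev SampleAlgorithm (G V : Type*) [AddGroup G] (T : ℕ) : Type _ :=
  (Fin T → G × V) → PMF (AddSubgroup G)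

/-- The law of the output of the algorithm `A` on `T` i.i.d. uniform examples `(x, f x)`. The tuple
of `T` i.i.d. uniform elements of `G` is a uniform element of `Fin T → G`. -/
def outputLaw {G V : Type*} [AddGroup G] [Fintype G] {T : ℕ} (A : SampleAlgorithm G V T)
    (f : G → V) : PMF (AddSubgroup G) :=
  (PMF.uniformOfFintype (Fin T → G)).bind fun x => A fun t => (x t, f (x t))

/-- `T` uniform examples suffice to identify, with error probability at most `δ` in the worst case,
the subgroup hidden by a function `f : G → V`, given that it belongs to `𝓗`. -/
def SolvableWith {G : Type*} [AddGroup G] [Fintype G] (𝓗 : Set (AddSubgroup G)) (V : Type*)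
    (δ : ℝ) (T : ℕ) : Prop :=
  ∃ A : SampleAlgorithm G V T, ∀ H ∈ 𝓗, ∀ f : G → V, Hides f H →
    1 - δ ≤ (outputLaw A f H).toReal

/-- The sample complexity of the hidden subgroup problem with candidate set `𝓗` and error `δ`:
the least number of uniform examples that suffices (`⊤` if no finite number does). -/
def sampleComplexity {G : Type*} [AddGroup G] [Fintype G] (𝓗 : Set (AddSubgroup G)) (V : Type*)
    (δ : ℝ) : ℕ∞ :=
  ⨅ (T : ℕ) (_ : SolvableWith 𝓗 V δ T), (T : ℕ∞)

/-- The group `ℤ_{p₁}^{n₁} × ⋯ × ℤ_{p_m}^{n_m}`. -/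
abbrev PrimePowerProd {m : ℕ} (p n : Fin m → ℕ) : Type :=
  ∀ i : Fin m, Fin (n i) → ZMod (p i)

/-- The candidate subgroups of the restricted Abelian hidden subgroup problem: the products
`H₁ × ⋯ × H_m` with `H_i ≤ ℤ_{p_i}^{n_i}` of rank (least cardinality of a generating set) `k_i`. -/
def rAHSPCandidates {m : ℕ} (p n k : Fin m → ℕ) [∀ i, Fact (p i).Prime] :
    Set (AddSubgroup (PrimePowerProd p n)) :=
  {H | ∃ K : ∀ i : Fin m, AddSubgroup (Fin (n i) → ZMod (p i)),
    (∀ i, AddGroup.rank (K i) = k i) ∧ H = AddSubgroup.pi Set.univ K}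

end HiddenSubgroup

end

/-!
Write `N` for the common index of the candidates. Everything rests on the repetitions among the
cosets of the sample points: when the cosets are labelled at random, the labels carry no information
beyond the pattern of coincidences `f x = f y`, and each coincidence reveals an element `x - y` of
`H`.

*Lower bound.* The kernels of the maps `(a, b) ↦ b - B a`, for tuples `B` of matrices over the
fields `ZMod (p i)`, form a family of at least `N ^ κ` candidates, where `κ = min k i`. With a fixed
labelling of the cosets only `N ^ T` label sequences can occur, so `T ≥ κ`
(`card_family_le_card_pow`). If the labelling is a uniformly random permutation, candidates that
produce the same repetition pattern on given samples cannot be told apart. A pattern with at most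
`R` repetitions is one of `(T ^ 2) ^ R`, and by Markov's inequality the number of repetitions is
typically at most of the order of `T ^ 2 / N` (`family_success_le`). If `T` is small compared with
`√(κ N)`, then `R < κ / 2` suffices, and (when `N` is large compared with `κ`, the other case being
covered by `T ≥ κ`) the number of patterns is far below `N ^ κ` (`lower_bound_of_family`).

*Upper bound.* The algorithm outputs the subgroup generated by the differences of colliding
samples. An exponential moment for balls in bins shows that there are at least `M` repetitions with
high probability, once the number of samples is a large multiple of `max M (√(M N))`
(`card_few_repeats_le`). Given the cosets of the samples, the components in `H` are independent and
uniform. If the differences generate a proper subgroup, a nonzero homomorphism `H →+ ZMod ℓ` with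
`ℓ` prime kills them all, which has probability at most `ℓ ^ (-M)` for each single homomorphism
(`card_respects_mul_pow_le`). There are at most `ℓ ^ (μ * max k i)` homomorphisms
(`card_hom_le_of_mem_candidates`), as no prime occurs more than `μ` times, so for
`M = μ * max k i + s + 2` the union bound over all `ℓ` is at most
`∑ ℓ, ℓ ^ (-(s + 2)) ≤ 2 ^ (-s)` (`card_not_generating_le`).
-/

namespace HiddenSubgroup

open Finset

/-! ### Repetitions in a finite sequence -/

/-- A choice of representatives of the fibres of `q`: `rep q t` depends only on `q t`, and
`q (rep q t) = q t`. -/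
noncomputable def rep {ι Q : Type*} (q : ι → Q) (t : ι) : ι :=
  Set.rangeSplitting q ⟨q t, t, rfl⟩

lemma apply_rep {ι Q : Type*} (q : ι → Q) (t : ι) : q (rep q t) = q t :=
  Set.apply_rangeSplitting q ⟨q t, t, rfl⟩

lemma rep_eq_rep_iff {ι Q : Type*} (q : ι → Q) (s t : ι) : rep q s = rep q t ↔ q s = q t := by
  constructor
  · intro h
    rw [← apply_rep q s, h, apply_rep q t]
  · intro h
    unfold rep
    congr 1
    exact Subtype.ext h

lemma rep_rep {ι Q : Type*} (q : ι → Q) (t : ι) : rep q (rep q t) = rep q t :=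
  (rep_eq_rep_iff q _ _).2 (apply_rep q t)

open scoped Classical in
/-- The repetitions in the sequence `q`: the positions that are not the chosen representative of
their fibre. Their number is the length of `q` minus the number of distinct values. -/
noncomputable def repeats {ι Q : Type*} [Fintype ι] (q : ι → Q) : Finset ι :=
  univ.filter fun t => rep q t ≠ t

lemma mem_repeats {ι Q : Type*} [Fintype ι] {q : ι → Q} {t : ι} :
    t ∈ repeats q ↔ rep q t ≠ t := by
  classical
  simp [repeats]

lemma card_repeats_add_card_image {ι Q : Type*} [Fintype ι] [DecidableEq Q] (q : ι → Q) :
    (repeats q).card + (univ.image q).card = Fintype.card ι := by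
  classical
  have h : (univ.image q).card = (univ.filter fun t => rep q t = t).card := by
    refine (card_nbij q ?_ ?_ ?_).symm
    · intro t _
      simp
    · intro s hs t ht hst
      simp only [coe_filter, mem_univ, true_and, Set.mem_ofPred_eq] at hs ht
      rw [← hs, ← ht, rep_eq_rep_iff]
      exact hst
    · intro y hy
      obtain ⟨t, -, rfl⟩ := by simpa using hy
      exact ⟨rep q t, by simp [rep_rep], apply_rep q t⟩
  have h2 := card_filter_add_card_filter_not (s := (univ : Finset ι)) (fun t => rep q t = t)
  rw [h, ← card_univ, ← h2, add_comm]
  rfl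

lemma card_repeats_le_card_collisions {ι Q : Type*} [Fintype ι] [DecidableEq Q] [DecidableEq ι]
    (q : ι → Q) :
    (repeats q).card ≤ (univ.filter fun st : ι × ι => st.1 ≠ st.2 ∧ q st.1 = q st.2).card := by
  refine card_le_card_of_injOn (fun t => (rep q t, t)) ?_ ?_
  · intro t ht
    simpa using ⟨mem_repeats.1 ht, apply_rep q t⟩
  · intro s _ t _ h
    exact (Prod.ext_iff.1 h).2

/-- A self-map with at most `R` non-fixed points is encoded by `R` pairs (point, image). -/
lemma card_filter_card_moved_le (T R : ℕ) (hT : 0 < T) :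
    (univ.filter fun ρ : Fin T → Fin T => (univ.filter fun t => ρ t ≠ t).card ≤ R).card
      ≤ (T * T) ^ R := by
  classical
  let dec : (Fin R → Fin T × Fin T) → Fin T → Fin T := fun c t =>
    if h : ∃ j, (c j).1 = t then (c h.choose).2 else t
  have key : Set.SurjOn dec (univ : Finset (Fin R → Fin T × Fin T))
      (univ.filter fun ρ : Fin T → Fin T => (univ.filter fun t => ρ t ≠ t).card ≤ R) := by
    intro ρ hρ
    simp only [coe_filter, mem_univ, true_and, Set.mem_ofPred_eq] at hρ
    obtain ⟨c, hc⟩ : ∃ c : Fin R → Fin T, ∀ t, ρ t ≠ t → ∃ j, c j = t := by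
      let S := univ.filter fun t => ρ t ≠ t
      refine ⟨fun j => if h : (j : ℕ) < S.card then S.equivFin.symm ⟨j, h⟩ else ⟨0, hT⟩, ?_⟩
      intro t ht
      have htS : t ∈ S := by simpa [S] using ht
      refine ⟨⟨S.equivFin ⟨t, htS⟩, lt_of_lt_of_le (S.equivFin ⟨t, htS⟩).2 hρ⟩, ?_⟩
      simp
    refine ⟨fun j => (c j, ρ (c j)), by simp, ?_⟩
    funext t
    by_cases h : ∃ j, c j = t
    · have := h.choose_spec
      simp only [dec, dif_pos h]
      rw [this]
    · have ht : ρ t = t := by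
        by_contra hne
        exact h (hc t hne)
      simp only [dec, dif_neg h, ht]
  refine (card_le_card_of_surjOn dec key).trans ?_
  simp

/-- Two sequences with the same pattern of repetitions differ by a permutation of the values. -/
lemma exists_perm_comp_eq {ι Q : Type*} [Finite Q] (q q' : ι → Q)
    (h : rep q = rep q') : ∃ σ : Equiv.Perm Q, q' = σ ∘ q := by
  classical
  have := Fintype.ofFinite Q
  have hk : ∀ s t, q s = q t ↔ q' s = q' t := fun s t => by
    rw [← rep_eq_rep_iff, h, rep_eq_rep_iff]
  let e : {y // y ∈ Set.range q} ≃ {y // y ∈ Set.range q'} :=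
    { toFun := fun y => ⟨q' (Set.rangeSplitting q y), _, rfl⟩
      invFun := fun y => ⟨q (Set.rangeSplitting q' y), _, rfl⟩
      left_inv := by
        rintro ⟨_, t, rfl⟩
        apply Subtype.ext
        change q (rep q' (rep q t)) = q t
        exact ((hk _ _).2 (apply_rep q' (rep q t))).trans (apply_rep q t)
      right_inv := by
        rintro ⟨_, t, rfl⟩
        apply Subtype.ext
        change q' (rep q (rep q' t)) = q' t
        exact ((hk _ _).1 (apply_rep q (rep q' t))).trans (apply_rep q' t) }
  refine ⟨e.extendSubtype, ?_⟩
  funext t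
  rw [Function.comp_apply, Equiv.extendSubtype_apply_of_mem e (q t) ⟨t, rfl⟩]
  change q' t = q' (rep q t)
  rw [h, apply_rep q' t]

/-! ### Success probabilities -/

lemma sum_toReal_apply_le_one {α ι : Type*} (μ : PMF α) (s : Finset ι) (e : ι → α)
    (he : Set.InjOn e s) : ∑ i ∈ s, (μ (e i)).toReal ≤ 1 := by
  classical
  rw [← ENNReal.toReal_sum (fun i _ => μ.apply_ne_top _), ← ENNReal.toReal_one]
  refine ENNReal.toReal_mono ENNReal.one_ne_top ?_
  rw [← sum_image (g := e) (f := fun a => μ a) he, ← μ.tsum_coe]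
  exact ENNReal.sum_le_tsum _

lemma outputLaw_toReal {G V : Type*} [AddGroup G] [Fintype G] {T : ℕ}
    (A : SampleAlgorithm G V T) (f : G → V) (H : AddSubgroup G) :
    (outputLaw A f H).toReal * (Fintype.card G : ℝ) ^ T =
      ∑ x : Fin T → G, (A (fun t => (x t, f (x t))) H).toReal := by
  classical
  have hG : (0 : ℝ) < Fintype.card G := by exact_mod_cast Fintype.card_pos
  unfold outputLaw
  rw [PMF.bind_apply, tsum_fintype, ENNReal.toReal_sum
    (fun i _ => ENNReal.mul_ne_top (PMF.apply_ne_top _ _) (PMF.apply_ne_top _ _)), sum_mul]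
  refine sum_congr rfl fun x _ => ?_
  rw [ENNReal.toReal_mul, PMF.uniformOfFintype_apply, ENNReal.toReal_inv, ENNReal.toReal_natCast]
  simp only [Fintype.card_pi, prod_const, card_univ, Fintype.card_fin, Nat.cast_pow]
  field_simp

/-! ### The lower bound for a family of kernels -/

lemma Hides.comp_injective {G V W : Type*} [AddGroup G] {f : G → V} {H : AddSubgroup G}
    (hf : Hides f H) {g : V → W} (hg : Function.Injective g) : Hides (g ∘ f) H := fun x y => by
  rw [← hf x y]
  exact hg.eq_iff

/-- A fixed pair of positions collides with probability at most `1 / |Q|`: shifting the entry at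
`s` by a lift of `z : Q` maps `Q × {x | u (x s) = u (x t)}` injectively into `ι → G`. -/
lemma card_mul_card_collision_le {ι G Q : Type*} [Fintype ι] [DecidableEq ι] [AddCommGroup G]
    [Fintype G] [AddCommGroup Q] [Fintype Q] [DecidableEq Q] (u : G →+ Q)
    (hu : Function.Surjective u) {s t : ι} (hst : s ≠ t) :
    Fintype.card Q * (univ.filter fun x : ι → G => u (x s) = u (x t)).card
      ≤ Fintype.card (ι → G) := by
  classical
  rw [← card_univ (α := Q), ← card_product, ← card_univ (α := ι → G)]
  let lift : Q → G := Function.surjInv hu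
  have hlift : ∀ z, u (lift z) = z := Function.surjInv_eq hu
  refine card_le_card_of_injOn (fun zx => Function.update zx.2 s (zx.2 s + lift zx.1))
    (by simp) ?_
  rintro ⟨z, x⟩ hx ⟨z', x'⟩ hx' h
  simp only [coe_product, coe_univ, coe_filter, mem_univ, true_and, Set.mem_prod, Set.mem_univ,
    Set.mem_ofPred_eq] at hx hx'
  have hoff : ∀ r, r ≠ s → x r = x' r := fun r hr => by
    simpa [Function.update_of_ne hr] using congrFun h r
  have hs : x s + lift z = x' s + lift z' := by simpa using congrFun h s
  have hz : z = z' := by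
    have := congrArg u hs
    rw [map_add, map_add, hlift, hlift, hx, hx', hoff t hst.symm] at this
    exact add_left_cancel this
  subst hz
  refine Prod.ext rfl (funext fun r => ?_)
  by_cases hr : r = s
  · subst hr
    exact add_right_cancel hs
  · exact hoff r hr

/-- Markov's inequality for the number of repetitions among `T` uniform samples. -/
lemma card_many_repeats_le {T : ℕ} {G Q : Type*} [AddCommGroup G] [Fintype G]
    [AddCommGroup Q] [Fintype Q] (u : G →+ Q) (hu : Function.Surjective u) (R : ℕ) :
    (R + 1) * Fintype.card Q *
        (univ.filter fun x : Fin T → G => R < (repeats (fun t => u (x t))).card).card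
      ≤ T * T * Fintype.card (Fin T → G) := by
  classical
  set B := univ.filter fun x : Fin T → G => R < (repeats (fun t => u (x t))).card with hB
  have h1 : (R + 1) * B.card ≤ ∑ x : Fin T → G, ∑ st : Fin T × Fin T,
      if st.1 ≠ st.2 ∧ u (x st.1) = u (x st.2) then 1 else 0 := by
    calc (R + 1) * B.card = ∑ x ∈ B, (R + 1) := by simp [mul_comm]
      _ ≤ ∑ x ∈ B, ∑ st : Fin T × Fin T,
          if st.1 ≠ st.2 ∧ u (x st.1) = u (x st.2) then 1 else 0 := by
        refine sum_le_sum fun x hx => ?_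
        rw [hB, mem_filter] at hx
        rw [← card_filter]
        exact (Nat.succ_le_of_lt hx.2).trans (card_repeats_le_card_collisions fun t => u (x t))
      _ ≤ _ := sum_le_sum_of_subset (subset_univ _)
  rw [sum_comm] at h1
  calc (R + 1) * Fintype.card Q * B.card = Fintype.card Q * ((R + 1) * B.card) := by ring
    _ ≤ Fintype.card Q * _ := Nat.mul_le_mul_left _ h1
    _ ≤ ∑ st : Fin T × Fin T, Fintype.card (Fin T → G) := by
      rw [mul_sum]
      refine sum_le_sum fun st _ => ?_
      by_cases hst : st.1 = st.2
      · simp [hst]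
      · simp only [ne_eq, hst, not_false_eq_true, true_and, ← card_filter]
        exact card_mul_card_collision_le u hu hst
    _ = _ := by simp

/-- For fixed samples `x` and uniformly random labels, the candidates whose repetition pattern
is `ρ` are indistinguishable, so that together they contribute at most one unit of success. -/
lemma sum_perm_success_le {T : ℕ} {G Q V ι : Type*} [AddGroup G] [Fintype Q] [DecidableEq Q]
    {A : SampleAlgorithm G V T} {u : ι → G → Q} {H : ι → AddSubgroup G}
    (hH : Function.Injective H) (g : Q ↪ V) (x : Fin T → G)
    (ρ : Fin T → Fin T) (S : Finset ι) (hS : ∀ i ∈ S, rep (fun t => u i (x t)) = ρ) :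
    ∑ i ∈ S, ∑ π : Equiv.Perm Q, (A (fun t => (x t, g (π (u i (x t))))) (H i)).toReal
      ≤ Fintype.card (Equiv.Perm Q) := by
  classical
  rcases S.eq_empty_or_nonempty with rfl | ⟨i₀, hi₀⟩
  · simp
  have hσ : ∀ i ∈ S, ∑ π : Equiv.Perm Q, (A (fun t => (x t, g (π (u i (x t))))) (H i)).toReal
      = ∑ π : Equiv.Perm Q, (A (fun t => (x t, g (π (u i₀ (x t))))) (H i)).toReal := by
    intro i hi
    obtain ⟨σ, hσ⟩ := exists_perm_comp_eq (fun t => u i₀ (x t)) (fun t => u i (x t))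
      ((hS i₀ hi₀).trans (hS i hi).symm)
    refine Fintype.sum_equiv (Equiv.mulRight σ) _ _ fun π => ?_
    have : ∀ t, u i (x t) = σ (u i₀ (x t)) := fun t => congrFun hσ t
    simp [this]
  rw [sum_congr rfl hσ, sum_comm]
  calc _ ≤ ∑ π : Equiv.Perm Q, (1 : ℝ) :=
        sum_le_sum fun π _ => sum_toReal_apply_le_one _ _ _ hH.injOn
    _ = _ := by simp

section Family

variable {T : ℕ} {G Q V ι : Type*} [AddCommGroup G] [Fintype G] [AddCommGroup Q] [Fintype Q]
  [Fintype ι] {A : SampleAlgorithm G V T} {δ : ℝ} {u : ι → G →+ Q} {H : ι → AddSubgroup G}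

/-- With a fixed injective labelling `g` of the cosets, the algorithm sees one of at most `|Q| ^ T`
label sequences, and each of them leads to a correct answer for at most one candidate on average. -/
lemma card_family_le_card_pow (hH : Function.Injective H) (hu : ∀ i, Hides (u i) (H i))
    (g : Q ↪ V) (hA : ∀ i, ∀ f : G → V, Hides f (H i) → 1 - δ ≤ (outputLaw A f (H i)).toReal) :
    (1 - δ) * Fintype.card ι ≤ (Fintype.card Q : ℝ) ^ T := by
  classical
  have hG : (0 : ℝ) < (Fintype.card G : ℝ) ^ T := pow_pos (by exact_mod_cast Fintype.card_pos) T
  refine le_of_mul_le_mul_right ?_ hG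
  calc (1 - δ) * Fintype.card ι * (Fintype.card G : ℝ) ^ T
      = ∑ i : ι, (1 - δ) * (Fintype.card G : ℝ) ^ T := by
        rw [sum_const, card_univ, nsmul_eq_mul]; ring
    _ ≤ ∑ i : ι, ∑ x : Fin T → G, (A (fun t => (x t, g (u i (x t)))) (H i)).toReal := by
        refine sum_le_sum fun i _ => ?_
        have := outputLaw_toReal A (g ∘ u i) (H i)
        simp only [Function.comp_apply] at this
        rw [← this]
        exact mul_le_mul_of_nonneg_right (hA i _ ((hu i).comp_injective g.injective)) hG.le
    _ = ∑ x : Fin T → G, ∑ i : ι, (A (fun t => (x t, g (u i (x t)))) (H i)).toReal := sum_comm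
    _ ≤ ∑ x : Fin T → G, ∑ i : ι, ∑ l : Fin T → Q,
          (A (fun t => (x t, g (l t))) (H i)).toReal := by
        refine sum_le_sum fun x _ => sum_le_sum fun i _ => ?_
        exact single_le_sum (f := fun l : Fin T → Q => (A (fun t => (x t, g (l t))) (H i)).toReal)
          (fun _ _ => ENNReal.toReal_nonneg) (mem_univ fun t => u i (x t))
    _ ≤ ∑ x : Fin T → G, ∑ l : Fin T → Q, 1 := by
        refine sum_le_sum fun x _ => ?_
        rw [sum_comm]
        exact sum_le_sum fun l _ => sum_toReal_apply_le_one _ _ _ hH.injOn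
    _ = _ := by simp; ring

/-- Under random labels, a sequence of samples with at most `R` repetitions shows one of at most
`(T ^ 2) ^ R` patterns; sequences with more repetitions are rare. These two cases account for the
second and the first summand on the right; both sides are scaled by `(R + 1) * |Q|`. -/
lemma family_success_le (hT : 0 < T) (hH : Function.Injective H) (hu : ∀ i, Hides (u i) (H i))
    (hsurj : ∀ i, Function.Surjective (u i)) (g : Q ↪ V)
    (hA : ∀ i, ∀ f : G → V, Hides f (H i) → 1 - δ ≤ (outputLaw A f (H i)).toReal) (R : ℕ) :
    (1 - δ) * Fintype.card ι * ((R + 1) * Fintype.card Q)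
      ≤ T * T * Fintype.card ι + ((T : ℝ) * T) ^ R * ((R + 1) * Fintype.card Q) := by
  classical
  have hG : (0 : ℝ) < (Fintype.card G : ℝ) ^ T := pow_pos (by exact_mod_cast Fintype.card_pos) T
  have hP : (0 : ℝ) < Fintype.card (Equiv.Perm Q) := by exact_mod_cast Fintype.card_pos
  let d : ι → (Fin T → G) → ℕ := fun i x => (repeats (fun t => u i (x t))).card
  let F : ι → (Fin T → G) → ℝ := fun i x =>
    ∑ π : Equiv.Perm Q, (A (fun t => (x t, g (π (u i (x t))))) (H i)).toReal
  have hF : ∀ i x, F i x ≤ Fintype.card (Equiv.Perm Q) := fun i x => by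
    calc F i x ≤ ∑ π : Equiv.Perm Q, (1 : ℝ) := sum_le_sum fun π _ =>
          ENNReal.toReal_mono ENNReal.one_ne_top (PMF.coe_le_one _ _)
      _ = _ := by simp
  have hgood : ∀ x, ∑ i ∈ univ.filter (fun i => ¬ R < d i x), F i x
      ≤ ((T : ℝ) * T) ^ R * Fintype.card (Equiv.Perm Q) := by
    intro x
    let P := univ.filter fun ρ : Fin T → Fin T => (univ.filter fun t => ρ t ≠ t).card ≤ R
    have hmap : ∀ i ∈ univ.filter (fun i => ¬ R < d i x), rep (fun t => u i (x t)) ∈ P := by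
      intro i hi
      have : d i x ≤ R := not_lt.1 (mem_filter.1 hi).2
      rw [mem_filter]
      refine ⟨mem_univ _, le_trans (le_of_eq ?_) this⟩
      congr 1
      ext t
      simp [mem_repeats]
    rw [← sum_fiberwise_of_maps_to hmap]
    calc _ ≤ ∑ ρ ∈ P, (Fintype.card (Equiv.Perm Q) : ℝ) := by
          refine sum_le_sum fun ρ _ =>
            sum_perm_success_le (u := fun i => u i) hH g x ρ _ fun i hi => ?_
          exact (mem_filter.1 hi).2
      _ = P.card * (Fintype.card (Equiv.Perm Q) : ℝ) := by simp
      _ ≤ _ := by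
          refine mul_le_mul_of_nonneg_right ?_ hP.le
          exact_mod_cast card_filter_card_moved_le T R hT
  have hbad : ∀ i, ((R : ℝ) + 1) * Fintype.card Q * (univ.filter fun x => R < d i x).card
      ≤ T * T * (Fintype.card G : ℝ) ^ T := fun i => by
    have := card_many_repeats_le (T := T) (u i) (hsurj i) R
    rw [Fintype.card_pi, prod_const, card_univ, Fintype.card_fin] at this
    exact_mod_cast this
  have hlow : (1 - δ) * Fintype.card ι * (Fintype.card G : ℝ) ^ T * Fintype.card (Equiv.Perm Q)
      ≤ ∑ i, ∑ x, F i x := by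
    calc _ = ∑ i : ι, ∑ π : Equiv.Perm Q, (1 - δ) * (Fintype.card G : ℝ) ^ T := by
          simp only [sum_const, card_univ, nsmul_eq_mul]; ring
      _ ≤ ∑ i : ι, ∑ π : Equiv.Perm Q,
            ∑ x : Fin T → G, (A (fun t => (x t, g (π (u i (x t))))) (H i)).toReal := by
          refine sum_le_sum fun i _ => sum_le_sum fun π _ => ?_
          have := outputLaw_toReal A (g ∘ π ∘ u i) (H i)
          simp only [Function.comp_apply] at this
          rw [← this]
          exact mul_le_mul_of_nonneg_right
            (hA i _ (((hu i).comp_injective π.injective).comp_injective g.injective)) hG.le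
      _ = _ := sum_congr rfl fun i _ => sum_comm
  have hup : ∑ i, ∑ x, F i x ≤ (∑ i, ((univ.filter fun x => R < d i x).card : ℝ)
      + (Fintype.card G : ℝ) ^ T * ((T : ℝ) * T) ^ R) * Fintype.card (Equiv.Perm Q) := by
    calc ∑ i, ∑ x, F i x = ∑ x, ∑ i, F i x := sum_comm
      _ = ∑ x, (∑ i ∈ univ.filter (fun i => R < d i x), F i x
            + ∑ i ∈ univ.filter (fun i => ¬ R < d i x), F i x) :=
          sum_congr rfl fun x _ => (sum_filter_add_sum_filter_not _ _ _).symm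
      _ ≤ ∑ x : Fin T → G, ((univ.filter (fun i => R < d i x)).card
            * (Fintype.card (Equiv.Perm Q) : ℝ)
            + ((T : ℝ) * T) ^ R * Fintype.card (Equiv.Perm Q)) := by
          refine sum_le_sum fun x _ => add_le_add ?_ (hgood x)
          refine (sum_le_sum fun i _ => hF i x).trans (le_of_eq ?_)
          simp
      _ = _ := by
          rw [sum_add_distrib, ← sum_mul, add_mul]
          congr 1
          · congr 1
            simp only [card_filter, Nat.cast_sum]
            exact sum_comm
          · simp [mul_assoc]
  have h3 := le_of_mul_le_mul_right (hlow.trans hup) hP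
  have h4 : ((R : ℝ) + 1) * Fintype.card Q * ∑ i, ((univ.filter fun x => R < d i x).card : ℝ)
      ≤ Fintype.card ι * (T * T * (Fintype.card G : ℝ) ^ T) := by
    rw [mul_sum]
    refine (sum_le_sum fun i _ => hbad i).trans (le_of_eq ?_)
    simp
  have hRQ : (0 : ℝ) ≤ ((R : ℝ) + 1) * Fintype.card Q := by positivity
  refine le_of_mul_le_mul_right ?_ hG
  have h5 := mul_le_mul_of_nonneg_left h3 hRQ
  linarith

/-- An identification algorithm for a family of at least `N ^ k` candidates, each of them the kernel
of a surjection onto a group of order `N`, uses at least `max k (√(kN) / 4)` samples. -/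
lemma lower_bound_of_family {k : ℕ} (hk : 0 < k) (hQ : 2 ≤ Fintype.card Q)
    (hcard : Fintype.card Q ^ k ≤ Fintype.card ι)
    (hH : Function.Injective H) (hu : ∀ i, Hides (u i) (H i))
    (hsurj : ∀ i, Function.Surjective (u i)) (g : Q ↪ V) (hδ : δ < 1 / 2)
    (hA : ∀ i, ∀ f : G → V, Hides f (H i) → 1 - δ ≤ (outputLaw A f (H i)).toReal) :
    (k : ℝ) ≤ T ∧ Real.sqrt (k * Fintype.card Q) ≤ 4 * T := by
  set N := Fintype.card Q with hN
  have hN2 : (2 : ℝ) ≤ N := by exact_mod_cast hQ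
  have hN0 : (0 : ℝ) < N := by linarith
  have hcard' : (N : ℝ) ^ k ≤ Fintype.card ι := by exact_mod_cast hcard
  have hι0 : (0 : ℝ) < Fintype.card ι := lt_of_lt_of_le (pow_pos hN0 k) hcard'
  have hkT : k ≤ T := by
    by_contra hlt
    push Not at hlt
    have h1 := card_family_le_card_pow hH hu g hA
    have h2 : (N : ℝ) ^ T * N ≤ N ^ k := by
      rw [← pow_succ]
      exact pow_le_pow_right₀ (by linarith) hlt
    have h3 : (N : ℝ) ^ T * 2 ≤ N ^ T * N := mul_le_mul_of_nonneg_left hN2 (by positivity)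
    nlinarith
  have hkT' : (k : ℝ) ≤ T := by exact_mod_cast hkT
  refine ⟨hkT', ?_⟩
  have hk1 : (1 : ℝ) ≤ k := by exact_mod_cast hk
  rw [Real.sqrt_le_left (by positivity)]
  by_contra hlt
  push Not at hlt
  -- `N ≤ 16 k` would give `√(kN) ≤ 4 k ≤ 4 T`.
  have hNk : 16 * (k : ℝ) < N := by nlinarith
  -- Markov's inequality asks for `R + 1 ≥ k / 2`, and the `N ^ (2 R)` patterns have to be few
  -- compared with the `N ^ k` candidates, so `2 R + 1 ≤ k`.
  obtain ⟨R, hR⟩ : ∃ R : ℕ, 2 * R + 1 ≤ k ∧ k ≤ 2 * (R + 1) := ⟨(k - 1) / 2, by omega, by omega⟩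
  have h1 := family_success_le (hk.trans_le hkT) hH hu hsurj g hA R
  have hR2 : (k : ℝ) ≤ 2 * (R + 1) := by exact_mod_cast hR.2
  have hTT : (T : ℝ) * T ≤ N ^ 2 := by nlinarith
  have h2 : ((T : ℝ) * T) ^ R * N ≤ Fintype.card ι := by
    calc ((T : ℝ) * T) ^ R * N ≤ (N ^ 2) ^ R * N := by gcongr
      _ = (N : ℝ) ^ (2 * R + 1) := by rw [← pow_mul, pow_succ]
      _ ≤ N ^ k := pow_le_pow_right₀ (by linarith) hR.1
      _ ≤ _ := hcard'
  have h3 : (T : ℝ) * T ≤ ((R : ℝ) + 1) * N / 8 := by nlinarith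
  have h4 : ((T : ℝ) * T) ^ R * 16 ≤ Fintype.card ι :=
    le_trans (mul_le_mul_of_nonneg_left (by nlinarith) (by positivity)) h2
  have hRN : (0 : ℝ) < ((R : ℝ) + 1) * N := by positivity
  have h5 : (T : ℝ) * T * Fintype.card ι ≤ ((R : ℝ) + 1) * N / 8 * Fintype.card ι :=
    mul_le_mul_of_nonneg_right h3 hι0.le
  have h6 : ((T : ℝ) * T) ^ R * (((R : ℝ) + 1) * N)
      ≤ Fintype.card ι / 16 * (((R : ℝ) + 1) * N) :=
    mul_le_mul_of_nonneg_right (by linarith) hRN.le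
  have h7 : 0 < Fintype.card ι * (((R : ℝ) + 1) * N) := by positivity
  have h8 : (1 / 2 : ℝ) * (Fintype.card ι * (((R : ℝ) + 1) * N))
      < (1 - δ) * (Fintype.card ι * (((R : ℝ) + 1) * N)) :=
    mul_lt_mul_of_pos_right (by linarith) h7
  linarith

end Family

/-! ### Generating a finite abelian group by random differences -/

lemma exists_addMonoidHom_ne_zero_of_module (A : Type*) [AddCommGroup A] [Nontrivial A] (ℓ : ℕ)
    [Fact ℓ.Prime] [Module (ZMod ℓ) A] : ∃ (φ : A →+ ZMod ℓ) (v : A), φ v ≠ 0 := by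
  obtain ⟨v, hv⟩ := exists_ne (0 : A)
  obtain ⟨φ, hφ⟩ := Module.Projective.exists_dual_ne_zero (ZMod ℓ) hv
  exact ⟨φ.toAddMonoidHom, v, hφ⟩

/-- A proper subgroup of a finite abelian group lies in the kernel of a nonzero homomorphism to
`ZMod ℓ` for some prime `ℓ` dividing the order of the group. -/
lemma exists_addMonoidHom_zmod {H : Type*} [AddCommGroup H] [Finite H] (D : AddSubgroup H)
    (hD : D ≠ ⊤) : ∃ ℓ : ℕ, ℓ.Prime ∧ ℓ ∣ Nat.card H ∧
      ∃ χ : H →+ ZMod ℓ, χ ≠ 0 ∧ ∀ x ∈ D, χ x = 0 := by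
  classical
  have hnt : Nontrivial (H ⧸ D) := QuotientAddGroup.nontrivial_iff.2 hD
  have hcard : Nat.card (H ⧸ D) ≠ 1 := Finite.one_lt_card.ne'
  obtain ⟨ℓ, hℓ, hdvd⟩ := Nat.exists_prime_and_dvd hcard
  have := Fact.mk hℓ
  -- Multiplication by `ℓ` on `H ⧸ D` is not injective, hence not surjective.
  let f : (H ⧸ D) →+ (H ⧸ D) := nsmulAddMonoidHom ℓ
  have hf : ¬ Function.Surjective f := by
    intro hs
    have hinj := Finite.injective_iff_surjective.2 hs
    obtain ⟨x, hx⟩ := exists_prime_addOrderOf_dvd_card' ℓ hdvd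
    have h0 : x = 0 := hinj (by
      change ℓ • x = ℓ • 0
      rw [← hx, addOrderOf_nsmul_eq_zero, nsmul_zero])
    rw [h0, addOrderOf_zero] at hx
    exact hℓ.one_lt.ne hx
  have hr : f.range ≠ ⊤ := fun h => hf (AddMonoidHom.range_eq_top.1 h)
  have hnt2 : Nontrivial ((H ⧸ D) ⧸ f.range) := QuotientAddGroup.nontrivial_iff.2 hr
  obtain ⟨φ, v, hφ⟩ := @exists_addMonoidHom_ne_zero_of_module ((H ⧸ D) ⧸ f.range) _ _ ℓ _
    (AddCommGroup.zmodModule <| by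
    intro y
    induction y using QuotientAddGroup.induction_on with
    | _ z => exact (QuotientAddGroup.eq_zero_iff _).2 ⟨z, rfl⟩)
  let ψ : H →+ (H ⧸ D) ⧸ f.range :=
    (QuotientAddGroup.mk' f.range).comp (QuotientAddGroup.mk' D)
  have hψ : Function.Surjective ψ :=
    (QuotientAddGroup.mk'_surjective _).comp (QuotientAddGroup.mk'_surjective _)
  refine ⟨ℓ, hℓ, hdvd.trans D.card_quotient_dvd_card, φ.comp ψ, ?_, ?_⟩
  · obtain ⟨h, rfl⟩ := hψ v
    intro h0
    exact hφ (DFunLike.congr_fun h0 h)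
  · intro x hx
    have : ψ x = 0 := by
      have h0 : QuotientAddGroup.mk' D x = 0 := (QuotientAddGroup.eq_zero_iff x).2 hx
      simp only [ψ, AddMonoidHom.comp_apply, h0, map_zero]
    change φ (ψ x) = 0
    rw [this, map_zero]

/-- For a fixed repetition pattern `q`, the values of a nonzero `χ` on a uniform sequence respect
the pattern with probability `ℓ ^ (-#repeats)`: shifts at the repeated positions by lifts of
elements of `ZMod ℓ` act freely. -/
lemma card_respects_mul_pow_le {ι Q H : Type*} [Fintype ι] [DecidableEq ι] [AddCommGroup H]
    [Fintype H] {ℓ : ℕ} [Fact ℓ.Prime] (χ : H →+ ZMod ℓ) (hχ : χ ≠ 0) (q : ι → Q)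
    [DecidablePred fun h : ι → H => ∀ s t, q s = q t → χ (h s) = χ (h t)] :
    (univ.filter fun h : ι → H => ∀ s t, q s = q t → χ (h s) = χ (h t)).card
        * ℓ ^ (repeats q).card ≤ Fintype.card (ι → H) := by
  classical
  have hsurj : Function.Surjective χ := by
    obtain ⟨a, ha⟩ : ∃ a, χ a ≠ 0 := by
      by_contra h
      push Not at h
      exact hχ (AddMonoidHom.ext h)
    have hr : χ.range = ⊤ := by
      have : Fact (Nat.card (ZMod ℓ)).Prime := ⟨by rw [Nat.card_zmod]; exact Fact.out⟩
      refine χ.range.eq_bot_or_eq_top_of_prime_card.resolve_left fun hb => ha ?_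
      have : χ a ∈ χ.range := ⟨a, rfl⟩
      rwa [hb, AddSubgroup.mem_bot] at this
    exact AddMonoidHom.range_eq_top.1 hr
  let lift : ZMod ℓ → H := Function.surjInv hsurj
  have hlift : ∀ z, χ (lift z) = z := Function.surjInv_eq hsurj
  have hpow : ℓ ^ (repeats q).card = (univ : Finset (repeats q → ZMod ℓ)).card := by
    simp [ZMod.card]
  rw [hpow, ← card_product, ← card_univ (α := ι → H)]
  refine card_le_card_of_injOn
    (fun hz t => hz.1 t + if ht : t ∈ repeats q then lift (hz.2 ⟨t, ht⟩) else 0) (by simp) ?_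
  rintro ⟨h, z⟩ hh ⟨h', z'⟩ hh' heq
  simp only [coe_product, coe_univ, coe_filter, mem_univ, true_and, Set.mem_prod, Set.mem_univ,
    Set.mem_ofPred_eq, and_true] at hh hh'
  have hfix : ∀ t, t ∉ repeats q → h t = h' t := fun t ht => by
    simpa [ht] using congrFun heq t
  have hval : ∀ t, χ (h t) = χ (h' t) := fun t => by
    rw [← hh _ _ (apply_rep q t), ← hh' _ _ (apply_rep q t), hfix]
    simp [mem_repeats, rep_rep]
  have hz : z = z' := by
    funext ⟨t, ht⟩
    have h1 : h t + lift (z ⟨t, ht⟩) = h' t + lift (z' ⟨t, ht⟩) := by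
      simpa [ht] using congrFun heq t
    have h2 := congrArg χ h1
    rw [map_add, map_add, hlift, hlift, hval] at h2
    exact add_left_cancel h2
  subst hz
  refine Prod.ext (funext fun t => ?_) rfl
  exact add_right_cancel (congrFun heq t)

lemma sum_inv_pow_le (P : Finset ℕ) (hP : ∀ ℓ ∈ P, 2 ≤ ℓ) (s : ℕ) :
    ∑ ℓ ∈ P, ((ℓ : ℝ) ^ (s + 2))⁻¹ ≤ ((2 : ℝ) ^ s)⁻¹ := by
  have h1 : ∀ n : ℕ, ∑ ℓ ∈ Finset.Ico 2 (n + 2), ((ℓ : ℝ) ^ 2)⁻¹ ≤ 1 - 1 / (n + 1 : ℝ) := by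
    intro n
    induction n with
    | zero => simp
    | succ n ih =>
      rw [show n + 1 + 2 = (n + 2) + 1 by ring, Finset.sum_Ico_succ_top (by omega)]
      have h2 : (((n + 2 : ℕ) : ℝ) ^ 2)⁻¹ ≤ 1 / (n + 1 : ℝ) - 1 / ((n + 1 : ℕ) + 1 : ℝ) := by
        push_cast
        rw [div_sub_div _ _ (by positivity) (by positivity), inv_eq_one_div,
          div_le_div_iff₀ (by positivity) (by positivity)]
        nlinarith
      linarith
  obtain ⟨n, hn⟩ : ∃ n, P ⊆ Finset.Ico 2 (n + 2) :=
    ⟨P.sup id, fun ℓ hℓ => Finset.mem_Ico.2 ⟨hP ℓ hℓ, by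
      have : ℓ ≤ P.sup id := Finset.le_sup (f := id) hℓ
      omega⟩⟩
  calc ∑ ℓ ∈ P, ((ℓ : ℝ) ^ (s + 2))⁻¹ ≤ ∑ ℓ ∈ P, ((2 : ℝ) ^ s)⁻¹ * ((ℓ : ℝ) ^ 2)⁻¹ := by
        refine sum_le_sum fun ℓ hℓ => ?_
        have h2 : (2 : ℝ) ≤ ℓ := by exact_mod_cast hP ℓ hℓ
        rw [pow_add, mul_inv]
        gcongr
    _ = ((2 : ℝ) ^ s)⁻¹ * ∑ ℓ ∈ P, ((ℓ : ℝ) ^ 2)⁻¹ := by rw [mul_sum]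
    _ ≤ ((2 : ℝ) ^ s)⁻¹ * 1 := by
        refine mul_le_mul_of_nonneg_left ?_ (by positivity)
        refine (sum_le_sum_of_subset_of_nonneg hn fun _ _ _ => by positivity).trans
          ((h1 n).trans ?_)
        have : (0 : ℝ) ≤ 1 / (n + 1 : ℝ) := by positivity
        linarith
    _ = _ := mul_one _

/-- For a repetition pattern `q` with sufficiently many repetitions, the differences of a uniform
sequence along `q` generate the group with high probability. -/
lemma card_not_generating_le {ι Q H : Type*} [Fintype ι] [DecidableEq ι] [AddCommGroup H]
    [Fintype H]
    (d s : ℕ) (hH : ∀ ℓ : ℕ, ℓ.Prime → Nat.card (H →+ ZMod ℓ) ≤ ℓ ^ d) (q : ι → Q)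
    (hq : d + (s + 2) ≤ (repeats q).card)
    [DecidablePred fun h : ι → H =>
      AddSubgroup.closure {y | ∃ s t, q s = q t ∧ y = h s - h t} ≠ ⊤] :
    ((univ.filter fun h : ι → H =>
        AddSubgroup.closure {y | ∃ s t, q s = q t ∧ y = h s - h t} ≠ ⊤).card : ℝ)
      ≤ ((2 : ℝ) ^ s)⁻¹ * Fintype.card (ι → H) := by
  classical
  set P := (Nat.card H).primeFactors with hP
  have hprime : ∀ ℓ ∈ P, ℓ.Prime := fun ℓ hℓ => Nat.prime_of_mem_primeFactors hℓ
  have hfin : ∀ ℓ : P, Finite (H →+ ZMod ℓ) := fun ℓ => by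
    have := Fact.mk (hprime ℓ ℓ.2)
    exact DFunLike.finite _
  let _ : ∀ ℓ : P, Fintype (H →+ ZMod ℓ) := fun ℓ => Fintype.ofFinite _
  have hsub : (univ.filter fun h : ι → H =>
        AddSubgroup.closure {y | ∃ s t, q s = q t ∧ y = h s - h t} ≠ ⊤) ⊆
      (univ : Finset P).biUnion fun ℓ => (univ.filter fun χ : H →+ ZMod ℓ => χ ≠ 0).biUnion
        fun χ => univ.filter fun h : ι → H => ∀ s t, q s = q t → χ (h s) = χ (h t) := by
    intro h hh
    obtain ⟨ℓ, hℓ, hdvd, χ, hχ, hker⟩ := exists_addMonoidHom_zmod _ (mem_filter.1 hh).2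
    have hmem : ℓ ∈ P := Nat.mem_primeFactors.2 ⟨hℓ, hdvd, Nat.card_pos.ne'⟩
    refine mem_biUnion.2 ⟨⟨ℓ, hmem⟩, mem_univ _, mem_biUnion.2 ⟨χ, by simpa using hχ, ?_⟩⟩
    refine mem_filter.2 ⟨mem_univ _, fun s t hst => ?_⟩
    rw [← sub_eq_zero, ← map_sub]
    exact hker _ (AddSubgroup.subset_closure ⟨s, t, hst, rfl⟩)
  have hone : ∀ (ℓ : P) (χ : H →+ ZMod ℓ), χ ≠ 0 →
      ((univ.filter fun h : ι → H => ∀ s t, q s = q t → χ (h s) = χ (h t)).card : ℝ)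
        ≤ ((ℓ : ℝ) ^ (d + (s + 2)))⁻¹ * Fintype.card (ι → H) := by
    intro ℓ χ hχ
    have := Fact.mk (hprime ℓ ℓ.2)
    have h1 := card_respects_mul_pow_le χ hχ q
    have hpos : (0 : ℝ) < (ℓ : ℝ) := by exact_mod_cast (hprime ℓ ℓ.2).pos
    rw [inv_mul_eq_div, le_div_iff₀ (by positivity)]
    refine le_trans (mul_le_mul_of_nonneg_left (pow_le_pow_right₀ ?_ hq) (by positivity))
      (by exact_mod_cast h1)
    exact_mod_cast (hprime ℓ ℓ.2).one_le
  calc _ ≤ (∑ ℓ : P, ∑ χ ∈ univ.filter fun χ : H →+ ZMod ℓ => χ ≠ 0,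
          ((univ.filter fun h : ι → H => ∀ s t, q s = q t → χ (h s) = χ (h t)).card : ℝ)) := by
        refine le_trans (Nat.cast_le.2 (card_le_card hsub)) ?_
        refine le_trans (Nat.cast_le.2 card_biUnion_le) ?_
        rw [Nat.cast_sum]
        refine sum_le_sum fun ℓ _ => ?_
        exact_mod_cast card_biUnion_le
    _ ≤ ∑ ℓ : P, ((ℓ : ℝ) ^ (s + 2))⁻¹ * Fintype.card (ι → H) := by
        refine sum_le_sum fun ℓ _ => ?_
        have hpos : (0 : ℝ) < (ℓ : ℝ) := by exact_mod_cast (hprime ℓ ℓ.2).pos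
        refine le_trans (sum_le_sum fun χ hχ => hone ℓ χ (mem_filter.1 hχ).2) ?_
        rw [sum_const, nsmul_eq_mul]
        have h2 : ((univ.filter fun χ : H →+ ZMod ℓ => χ ≠ 0).card : ℝ) ≤ (ℓ : ℝ) ^ d := by
          have := hH ℓ (hprime ℓ ℓ.2)
          rw [Nat.card_eq_fintype_card] at this
          exact_mod_cast (card_le_univ _).trans this
        calc _ ≤ (ℓ : ℝ) ^ d * (((ℓ : ℝ) ^ (d + (s + 2)))⁻¹ * Fintype.card (ι → H)) :=
              mul_le_mul_of_nonneg_right h2 (by positivity)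
          _ = _ := by
              rw [pow_add _ d]
              field_simp
    _ = (∑ ℓ ∈ P, ((ℓ : ℝ) ^ (s + 2))⁻¹) * Fintype.card (ι → H) := by
        rw [← sum_mul, sum_coe_sort P fun ℓ => ((ℓ : ℝ) ^ (s + 2))⁻¹]
    _ ≤ _ := mul_le_mul_of_nonneg_right
        (sum_inv_pow_le P (fun ℓ hℓ => (hprime ℓ hℓ).two_le) s) (by positivity)

/-! ### Balls in bins -/

/-- Among `2 τ` uniform samples from a set of size `N`, where `τ ^ 2` is large compared with
`N * M`, there are at least `M` repetitions with high probability. If the first half has fewer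
than `M` repetitions, it occupies at least `τ / 2` values, and the number `Z` of samples in the
second half that hit these values is controlled by the moment `2 ^ (-Z)`. -/
lemma card_few_repeats_le {Q : Type*} [Fintype Q] [Nonempty Q] {τ M : ℕ} {L : ℝ}
    (hM : 2 * M ≤ τ) (hL : 4 * Fintype.card Q * (M + L) ≤ (τ : ℝ) ^ 2) :
    ((univ.filter fun q : Fin (τ + τ) → Q => (repeats q).card < M).card : ℝ)
      ≤ Real.exp (-L) * Fintype.card (Fin (τ + τ) → Q) := by
  classical
  set N := Fintype.card Q with hN
  have hN0 : (0 : ℝ) < N := by exact_mod_cast Fintype.card_pos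
  let hits : (Fin τ → Q) → (Fin τ → Q) → ℕ := fun q₁ q₂ =>
    (univ.filter fun t => q₂ t ∈ univ.image q₁).card
  have hsplit : ∀ q₁ q₂ : Fin τ → Q,
      (repeats q₁).card + hits q₁ q₂ ≤ (repeats (Fin.append q₁ q₂)).card := by
    intro q₁ q₂
    have h1 := card_repeats_add_card_image q₁
    have h2 := card_repeats_add_card_image (Fin.append q₁ q₂)
    have h3 := card_filter_add_card_filter_not (s := (univ : Finset (Fin τ)))
      (fun t => q₂ t ∈ univ.image q₁)
    have h4 : (univ.image (Fin.append q₁ q₂)).card ≤ (univ.image q₁).card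
        + (univ.filter fun t => ¬ q₂ t ∈ univ.image q₁).card := by
      have hsub : univ.image (Fin.append q₁ q₂) ⊆ univ.image q₁ ∪
          (univ.filter fun t => ¬ q₂ t ∈ univ.image q₁).image q₂ := by
        intro y hy
        obtain ⟨t, -, rfl⟩ := mem_image.1 hy
        induction t using Fin.addCases with
        | left i => simp
        | right i =>
          rw [Fin.append_right, mem_union]
          by_cases h : q₂ i ∈ univ.image q₁
          · exact Or.inl h
          · exact Or.inr (mem_image_of_mem _ (mem_filter.2 ⟨mem_univ _, h⟩))
      exact (card_le_card hsub).trans ((card_union_le _ _).trans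
        (Nat.add_le_add_left card_image_le _))
    simp only [Fintype.card_fin, card_univ] at h1 h2 h3
    change _ + (univ.filter fun t => q₂ t ∈ univ.image q₁).card ≤ _
    omega
  have hfix : ∀ q₁ : Fin τ → Q,
      ((univ.filter fun q₂ : Fin τ → Q => (repeats (Fin.append q₁ q₂)).card < M).card : ℝ)
        ≤ Real.exp (-L) * (N : ℝ) ^ τ := by
    intro q₁
    by_cases hr : M ≤ (repeats q₁).card
    · rw [filter_false_of_mem]
      · simp only [card_empty, Nat.cast_zero]
        positivity
      · intro q₂ _
        have := hsplit q₁ q₂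
        omega
    set b := (univ.image q₁).card with hb
    have hb2 : (τ : ℝ) ≤ 2 * b := by
      have h1 := card_repeats_add_card_image q₁
      rw [Fintype.card_fin] at h1
      have : τ ≤ 2 * b := by omega
      exact_mod_cast this
    let w : Q → ℝ := fun z => if z ∈ univ.image q₁ then 1 / 2 else 1
    have hw : ∑ z, w z = N - b / 2 := by
      have : ∀ z, w z = 1 - if z ∈ univ.image q₁ then (1 / 2 : ℝ) else 0 := fun z => by
        by_cases h : z ∈ univ.image q₁ <;> simp only [w, h, if_true, if_false] <;> norm_num
      simp only [this, sum_sub_distrib]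
      rw [← sum_filter, sum_const, sum_const, card_univ, filter_mem_eq_inter, univ_inter]
      simp only [nsmul_eq_mul, mul_one]
      ring
    have hw0 : ∀ z, 0 ≤ w z := fun z => by
      by_cases h : z ∈ univ.image q₁ <;> simp only [w, h, if_true, if_false] <;> norm_num
    have hprod : ∀ q₂ : Fin τ → Q, ∏ t, w (q₂ t) = (1 / 2 : ℝ) ^ hits q₁ q₂ := fun q₂ => by
      simp only [w, prod_ite, prod_const, one_pow, mul_one, hits]
    have hexp : (2 : ℝ) ^ M ≤ Real.exp M := by
      rw [← Real.exp_one_pow]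
      have := Real.add_one_le_exp 1
      gcongr
      linarith
    calc ((univ.filter fun q₂ : Fin τ → Q => (repeats (Fin.append q₁ q₂)).card < M).card : ℝ)
        = ∑ q₂ ∈ univ.filter (fun q₂ : Fin τ → Q => (repeats (Fin.append q₁ q₂)).card < M),
            (1 : ℝ) := by simp
      _ ≤ ∑ q₂ ∈ univ.filter (fun q₂ : Fin τ → Q => (repeats (Fin.append q₁ q₂)).card < M),
            (2 : ℝ) ^ M * ∏ t, w (q₂ t) := by
          refine sum_le_sum fun q₂ hq₂ => ?_
          have h1 := (mem_filter.1 hq₂).2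
          have h2 : hits q₁ q₂ ≤ M := by
            have := hsplit q₁ q₂
            omega
          rw [hprod, one_div, inv_pow, ← div_eq_mul_inv, one_le_div (by positivity)]
          exact pow_le_pow_right₀ (by norm_num) h2
      _ ≤ ∑ q₂ : Fin τ → Q, (2 : ℝ) ^ M * ∏ t, w (q₂ t) :=
          sum_le_sum_of_subset_of_nonneg (subset_univ _) fun q₂ _ _ =>
            mul_nonneg (by positivity) (prod_nonneg fun t _ => hw0 _)
      _ = (2 : ℝ) ^ M * (N - b / 2) ^ τ := by
          rw [← mul_sum, ← hw, Fintype.sum_pow]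
      _ ≤ Real.exp M * (N * Real.exp (-(b / (2 * N)))) ^ τ := by
          have hbN : (b : ℝ) ≤ N := by exact_mod_cast card_le_univ _
          refine mul_le_mul hexp (pow_le_pow_left₀ (by linarith) ?_ τ) (pow_nonneg (by linarith) _)
            (Real.exp_pos _).le
          have h1 := Real.add_one_le_exp (-((b : ℝ) / (2 * N)))
          calc (N : ℝ) - b / 2 = N * (-(b / (2 * N)) + 1) := by field_simp; ring
            _ ≤ _ := mul_le_mul_of_nonneg_left h1 hN0.le
      _ = Real.exp (M - τ * (b / (2 * N))) * (N : ℝ) ^ τ := by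
          rw [mul_pow, ← Real.exp_nat_mul, sub_eq_add_neg, Real.exp_add]
          ring_nf
      _ ≤ _ := by
          refine mul_le_mul_of_nonneg_right (Real.exp_le_exp.2 ?_) (by positivity)
          have : (M : ℝ) + L ≤ τ * (b / (2 * N)) := by
            rw [← mul_div_assoc, le_div_iff₀ (by positivity)]
            have hτ : (0 : ℝ) ≤ τ := by positivity
            nlinarith
          linarith
  have hcount : ((univ.filter fun q : Fin (τ + τ) → Q => (repeats q).card < M).card : ℝ)
      = ∑ q₁ : Fin τ → Q,
        ((univ.filter fun q₂ : Fin τ → Q => (repeats (Fin.append q₁ q₂)).card < M).card : ℝ) := by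
    simp only [card_filter, Nat.cast_sum]
    rw [← Fintype.sum_prod_type']
    exact (Fintype.sum_equiv (Fin.appendEquiv τ τ) _ _ fun _ => rfl).symm
  rw [hcount]
  refine (sum_le_sum fun q₁ _ => hfix q₁).trans (le_of_eq ?_)
  simp [pow_add]
  ring

/-! ### The subgroup generated by the collisions -/

/-- The subgroup generated by the differences of sample points with equal labels. -/
def collisionSubgroup {G V : Type*} [AddGroup G] {T : ℕ} (D : Fin T → G × V) : AddSubgroup G :=
  AddSubgroup.closure {y | ∃ s t, (D s).2 = (D t).2 ∧ y = (D s).1 - (D t).1}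

/-- The bijection between `G` and `(G ⧸ H) × H` given by a choice of coset representatives. -/
noncomputable def cosetEquiv {G : Type*} [AddCommGroup G] (H : AddSubgroup G) :
    (G ⧸ H) × H ≃ G where
  toFun qh := qh.1.out + qh.2
  invFun x := (x, ⟨x - (x : G ⧸ H).out, by
    rw [← QuotientAddGroup.eq_iff_sub_mem, QuotientAddGroup.out_eq']⟩)
  left_inv := by
    rintro ⟨q, h⟩
    have hq : ((q.out + (h : G) : G) : G ⧸ H) = q := by
      rw [QuotientAddGroup.mk_add_of_mem _ h.2, QuotientAddGroup.out_eq']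
    simp [hq]
  right_inv x := by simp

lemma mk_cosetEquiv {G : Type*} [AddCommGroup G] (H : AddSubgroup G) (q : G ⧸ H) (h : H) :
    (cosetEquiv H (q, h) : G ⧸ H) = q :=
  congrArg Prod.fst ((cosetEquiv H).left_inv (q, h))

lemma Hides.eq_iff {G V : Type*} [AddCommGroup G] {f : G → V} {H : AddSubgroup G}
    (hf : Hides f H) (x y : G) : f x = f y ↔ (x : G ⧸ H) = y := by
  rw [QuotientAddGroup.eq, ← hf, add_neg_cancel_left]

lemma collisionSubgroup_eq_of_closure_eq_top {G V : Type*} [AddCommGroup G] {f : G → V}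
    {H : AddSubgroup G} (hf : Hides f H) {T : ℕ} (q : Fin T → G ⧸ H) (h : Fin T → H)
    (hgen : AddSubgroup.closure {y | ∃ s t, q s = q t ∧ y = h s - h t} = ⊤) :
    collisionSubgroup (fun t => (cosetEquiv H (q t, h t), f (cosetEquiv H (q t, h t)))) = H := by
  have hset : {y | ∃ s t, f (cosetEquiv H (q s, h s)) = f (cosetEquiv H (q t, h t)) ∧
      y = cosetEquiv H (q s, h s) - cosetEquiv H (q t, h t)}
      = H.subtype '' {y | ∃ s t, q s = q t ∧ y = h s - h t} := by
    ext y
    simp only [Set.mem_ofPred_eq, Set.mem_image, hf.eq_iff, mk_cosetEquiv]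
    constructor
    · rintro ⟨s, t, hst, rfl⟩
      exact ⟨h s - h t, ⟨s, t, hst, rfl⟩, by simp [cosetEquiv, hst]⟩
    · rintro ⟨_, ⟨s, t, hst, rfl⟩, rfl⟩
      exact ⟨s, t, hst, by simp [cosetEquiv, hst]⟩
  change AddSubgroup.closure _ = H
  rw [hset, ← AddMonoidHom.map_closure, hgen, ← AddMonoidHom.range_eq_map, AddSubgroup.range_subtype]

/-- The collisions of `2 τ` uniform samples generate the hidden subgroup with high probability:
the cosets `q` and the components `h` in `H` of the samples are independent and uniform, `q` has
enough repetitions with high probability, and given such a `q`, the differences generate `H`. -/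
lemma card_collisionSubgroup_ne_le {G V : Type*} [AddCommGroup G] [Fintype G] {f : G → V}
    {H : AddSubgroup G} (hf : Hides f H) {τ d s : ℕ} {L : ℝ}
    (hH : ∀ ℓ : ℕ, ℓ.Prime → Nat.card (H →+ ZMod ℓ) ≤ ℓ ^ d)
    (hM : 2 * (d + (s + 2)) ≤ τ)
    (hL : 4 * Nat.card (G ⧸ H) * (((d + (s + 2) : ℕ) : ℝ) + L) ≤ (τ : ℝ) ^ 2)
    [DecidablePred fun x : Fin (τ + τ) → G => collisionSubgroup (fun t => (x t, f (x t))) ≠ H] :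
    ((univ.filter fun x : Fin (τ + τ) → G =>
        collisionSubgroup (fun t => (x t, f (x t))) ≠ H).card : ℝ)
      ≤ (Real.exp (-L) + ((2 : ℝ) ^ s)⁻¹) * (Fintype.card G : ℝ) ^ (τ + τ) := by
  classical
  have := Fintype.ofFinite (G ⧸ H)
  rw [Nat.card_eq_fintype_card] at hL
  set T := τ + τ with hT
  let bad : (Fin T → G ⧸ H) → (Fin T → H) → Prop := fun q h =>
    AddSubgroup.closure {y | ∃ s t, q s = q t ∧ y = h s - h t} ≠ ⊤
  let E : (Fin T → G ⧸ H) × (Fin T → H) ≃ (Fin T → G) :=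
    (Equiv.arrowProdEquivProdArrow (Fin T) (fun _ => G ⧸ H) (fun _ => H)).symm.trans
      (Equiv.piCongrRight fun _ => cosetEquiv H)
  have hcardG : (Fintype.card G : ℝ) = Fintype.card (G ⧸ H) * Fintype.card H := by
    rw [← Nat.cast_mul, ← Fintype.card_prod, Fintype.card_congr (cosetEquiv H)]
  have hinner : ∀ q, ((univ.filter fun h => bad q h).card : ℝ) ≤
      (if (repeats q).card < d + (s + 2) then 1 else 0) * (Fintype.card H : ℝ) ^ T
        + ((2 : ℝ) ^ s)⁻¹ * (Fintype.card H : ℝ) ^ T := by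
    intro q
    by_cases hq : (repeats q).card < d + (s + 2)
    · rw [if_pos hq, one_mul]
      have h1 : ((univ.filter fun h => bad q h).card : ℝ) ≤ (Fintype.card H : ℝ) ^ T := by
        have := card_le_univ (univ.filter fun h => bad q h)
        rw [Fintype.card_pi, prod_const, card_univ, Fintype.card_fin] at this
        exact_mod_cast this
      have : (0 : ℝ) ≤ ((2 : ℝ) ^ s)⁻¹ * (Fintype.card H : ℝ) ^ T := by positivity
      linarith
    · rw [if_neg hq, zero_mul, zero_add]
      have := card_not_generating_le d s hH q (not_lt.1 hq)
      simpa using this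
  calc _ = ∑ x : Fin T → G,
        (if collisionSubgroup (fun t => (x t, f (x t))) ≠ H then (1 : ℝ) else 0) := by
        rw [card_filter, Nat.cast_sum]
        exact sum_congr rfl fun x _ => by split_ifs <;> simp
    _ = ∑ q : Fin T → G ⧸ H, ∑ h : Fin T → H,
        (if collisionSubgroup (fun t => (E (q, h) t, f (E (q, h) t))) ≠ H then (1 : ℝ) else 0) := by
        rw [← Fintype.sum_prod_type']
        exact (Fintype.sum_equiv E _ _ fun _ => rfl).symm
    _ ≤ ∑ q : Fin T → G ⧸ H, ∑ h : Fin T → H, (if bad q h then (1 : ℝ) else 0) := by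
        refine sum_le_sum fun q _ => sum_le_sum fun h _ => ?_
        by_cases hb : bad q h
        · rw [if_pos hb]
          split_ifs <;> norm_num
        · rw [if_neg hb, if_neg]
          exact not_not.2 (collisionSubgroup_eq_of_closure_eq_top hf q h (not_not.1 hb))
    _ = ∑ q : Fin T → G ⧸ H, ((univ.filter fun h => bad q h).card : ℝ) := by
        simp only [card_filter, Nat.cast_sum, Nat.cast_ite, Nat.cast_one, Nat.cast_zero]
    _ ≤ _ := sum_le_sum fun q _ => hinner q
    _ = (univ.filter fun q : Fin T → G ⧸ H => (repeats q).card < d + (s + 2)).card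
          * (Fintype.card H : ℝ) ^ T
        + (Fintype.card (G ⧸ H) : ℝ) ^ T * (((2 : ℝ) ^ s)⁻¹ * (Fintype.card H : ℝ) ^ T) := by
        rw [sum_add_distrib, ← sum_mul, card_filter, Nat.cast_sum]
        simp
    _ ≤ Real.exp (-L) * Fintype.card (Fin T → G ⧸ H) * (Fintype.card H : ℝ) ^ T
        + (Fintype.card (G ⧸ H) : ℝ) ^ T * (((2 : ℝ) ^ s)⁻¹ * (Fintype.card H : ℝ) ^ T) := by
        gcongr
        exact card_few_repeats_le hM hL
    _ = _ := by
        rw [hcardG, mul_pow]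
        simp
        ring

/-- The algorithm that outputs the subgroup generated by the collisions solves the problem. -/
lemma solvableWith_of_bounds {G V : Type*} [AddCommGroup G] [Fintype G] {𝓗 : Set (AddSubgroup G)}
    {τ d s N : ℕ} {L δ : ℝ}
    (hhom : ∀ H ∈ 𝓗, ∀ ℓ : ℕ, ℓ.Prime → Nat.card (H →+ ZMod ℓ) ≤ ℓ ^ d)
    (hindex : ∀ H ∈ 𝓗, Nat.card (G ⧸ H) = N)
    (hM : 2 * (d + (s + 2)) ≤ τ)
    (hL : 4 * N * (((d + (s + 2) : ℕ) : ℝ) + L) ≤ (τ : ℝ) ^ 2)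
    (hδ : Real.exp (-L) + ((2 : ℝ) ^ s)⁻¹ ≤ δ) : SolvableWith 𝓗 V δ (τ + τ) := by
  classical
  refine ⟨fun D => PMF.pure (collisionSubgroup D), fun H hH f hf => ?_⟩
  have hG : (0 : ℝ) < (Fintype.card G : ℝ) ^ (τ + τ) :=
    pow_pos (by exact_mod_cast Fintype.card_pos) _
  refine le_of_mul_le_mul_right ?_ hG
  rw [outputLaw_toReal]
  have hbad := card_collisionSubgroup_ne_le hf (hhom H hH) hM (L := L)
    (by rw [hindex H hH]; exact hL)
  have hsplit := card_filter_add_card_filter_not (s := (univ : Finset (Fin (τ + τ) → G)))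
    (fun x => collisionSubgroup (fun t => (x t, f (x t))) = H)
  have hsplit' : ((univ.filter fun x : Fin (τ + τ) → G =>
        collisionSubgroup (fun t => (x t, f (x t))) = H).card : ℝ)
      + (univ.filter fun x : Fin (τ + τ) → G =>
        collisionSubgroup (fun t => (x t, f (x t))) ≠ H).card
      = (Fintype.card G : ℝ) ^ (τ + τ) := by
    rw [card_univ, Fintype.card_pi, prod_const, card_univ, Fintype.card_fin] at hsplit
    exact_mod_cast hsplit
  have hsum : ∑ x : Fin (τ + τ) → G,
      (PMF.pure (collisionSubgroup fun t => (x t, f (x t))) H).toReal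
      = ((univ.filter fun x : Fin (τ + τ) → G =>
        collisionSubgroup (fun t => (x t, f (x t))) = H).card : ℝ) := by
    rw [card_filter, Nat.cast_sum]
    refine sum_congr rfl fun x _ => ?_
    rw [PMF.pure_apply]
    by_cases h : collisionSubgroup (fun t => (x t, f (x t))) = H
    · simp [h]
    · rw [if_neg (Ne.symm h), if_neg h]
      simp
  rw [hsum]
  have := mul_le_mul_of_nonneg_right hδ hG.le
  linarith

/-! ### The candidate subgroups -/

lemma rank_eq_finrank (p : ℕ) [Fact p.Prime] (A : Type*) [AddCommGroup A] [Finite A]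
    [Module (ZMod p) A] : AddGroup.rank A = Module.finrank (ZMod p) A := by
  classical
  apply le_antisymm
  · let b := Module.finBasis (ZMod p) A
    refine (AddGroup.rank_le (S := univ.image b) ?_).trans
      (card_image_le.trans (by simp))
    rw [eq_top_iff]
    intro x _
    have hle : Submodule.span (ZMod p) (Set.range b) ≤
        AddSubgroup.toZModSubmodule p (AddSubgroup.closure (Set.range b)) :=
      Submodule.span_le.2 AddSubgroup.subset_closure
    have hx : x ∈ Submodule.span (ZMod p) (Set.range b) := by simp [b.span_eq]
    simpa using hle hx
  · obtain ⟨S, hS, hgen⟩ := AddGroup.rank_spec A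
    rw [← hS]
    have hspan : Submodule.span (ZMod p) (S : Set A) = ⊤ := by
      rw [eq_top_iff]
      intro x _
      have hle : AddSubgroup.closure (S : Set A) ≤
          (Submodule.span (ZMod p) (S : Set A)).toAddSubgroup :=
        (AddSubgroup.closure_le _).2 Submodule.subset_span
      exact hle (by rw [hgen]; exact AddSubgroup.mem_top x)
    rw [← finrank_top, ← hspan]
    exact finrank_span_finset_le_card S

lemma card_eq_pow_rank_of_module (p : ℕ) [Fact p.Prime] (A : Type*) [AddCommGroup A] [Finite A]
    [Module (ZMod p) A] : Nat.card A = p ^ AddGroup.rank A := by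
  rw [rank_eq_finrank p A, Module.natCard_eq_pow_finrank (K := ZMod p), Nat.card_zmod]

lemma card_eq_pow_rank {p n : ℕ} [Fact p.Prime] (K : AddSubgroup (Fin n → ZMod p)) :
    Nat.card K = p ^ AddGroup.rank K :=
  @card_eq_pow_rank_of_module p _ K _ _
    (inferInstanceAs (Module (ZMod p) (AddSubgroup.toZModSubmodule p K)))

lemma card_pi_univ {m : ℕ} {G : Fin m → Type*} [∀ i, AddGroup (G i)]
    (K : ∀ i, AddSubgroup (G i)) :
    Nat.card (AddSubgroup.pi Set.univ K) = ∏ i, Nat.card (K i) := by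
  rw [← Nat.card_pi]
  exact Nat.card_congr (Equiv.Set.univPi fun i => (K i : Set (G i)))

lemma card_quotient_of_mem_candidates {m : ℕ} {p n k : Fin m → ℕ} [∀ i, Fact (p i).Prime]
    (hkn : ∀ i, k i ≤ n i) {H : AddSubgroup (PrimePowerProd p n)}
    (hH : H ∈ rAHSPCandidates p n k) :
    Nat.card (PrimePowerProd p n ⧸ H) = ∏ i, p i ^ (n i - k i) := by
  obtain ⟨K, hK, rfl⟩ := hH
  have h1 := AddSubgroup.card_eq_card_quotient_mul_card_addSubgroup (AddSubgroup.pi Set.univ K)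
  rw [card_pi_univ, prod_congr rfl fun i _ => (card_eq_pow_rank (K i)).trans (by rw [hK i])] at h1
  have hpos : 0 < ∏ i, p i ^ k i := prod_pos fun i _ => pow_pos (Fact.out : (p i).Prime).pos _
  refine Nat.eq_of_mul_eq_mul_right hpos (h1.symm.trans ?_)
  rw [← prod_mul_distrib, Nat.card_pi]
  refine prod_congr rfl fun i _ => ?_
  rw [← pow_add, Nat.sub_add_cancel (hkn i), Nat.card_fun]
  simp

/-- A homomorphism to `ZMod ℓ` vanishes on the factors with `p i ≠ ℓ` and is determined by its
values on `k i` generators of each of the other factors. -/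
lemma card_hom_le_of_mem_candidates {m : ℕ} {p n k : Fin m → ℕ} [∀ i, Fact (p i).Prime]
    {H : AddSubgroup (PrimePowerProd p n)} (hH : H ∈ rAHSPCandidates p n k)
    {ℓ : ℕ} (hℓ : ℓ.Prime) :
    Nat.card (H →+ ZMod ℓ) ≤ ℓ ^ ∑ i ∈ univ.filter (fun i => p i = ℓ), k i := by
  classical
  obtain ⟨K, hK, rfl⟩ := hH
  have := Fact.mk hℓ
  choose S hScard hSgen using fun i => AddGroup.rank_spec (K i)
  let incl : ∀ i, K i →+ AddSubgroup.pi Set.univ K := fun i =>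
    { toFun := fun y => ⟨Pi.single i (y : Fin (n i) → ZMod (p i)), by
        rw [AddSubgroup.mem_pi]
        intro j _
        by_cases h : j = i
        · subst h
          simp
        · rw [Pi.single_eq_of_ne h]
          exact (K j).zero_mem⟩
      map_zero' := by
        apply Subtype.ext
        simp
      map_add' := fun y z => by
        apply Subtype.ext
        simp [Pi.single_add] }
  let res : (AddSubgroup.pi Set.univ K →+ ZMod ℓ) → (Σ i : {i // p i = ℓ}, S i) → ZMod ℓ :=
    fun χ a => χ (incl a.1 a.2)
  have hres : Function.Injective res := by
    intro χ χ' h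
    have hcomp : ∀ i, χ.comp (incl i) = χ'.comp (incl i) := by
      intro i
      by_cases hi : p i = ℓ
      · refine AddMonoidHom.eq_of_eqOn_dense (hSgen i) fun y hy => ?_
        exact congrFun h ⟨⟨i, hi⟩, ⟨y, hy⟩⟩
      · have hzero : ∀ φ : K i →+ ZMod ℓ, φ = 0 := fun φ => by
          ext1 y
          have h1 : p i • y = 0 := by
            apply Subtype.ext
            funext j
            simp
          have h2 : (p i : ZMod ℓ) * φ y = 0 := by
            rw [← nsmul_eq_mul, ← map_nsmul, h1, map_zero]
          refine (mul_eq_zero.1 h2).resolve_left fun h3 => hi ?_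
          rw [ZMod.natCast_eq_zero_iff] at h3
          exact ((Nat.prime_dvd_prime_iff_eq hℓ Fact.out).1 h3).symm
        rw [hzero (χ.comp _), hzero (χ'.comp _)]
    ext1 y
    have hy : y = ∑ i, incl i ⟨y.1 i, (AddSubgroup.mem_pi _).1 y.2 i trivial⟩ := by
      apply Subtype.ext
      rw [AddSubgroup.val_finsetSum]
      exact (Finset.univ_sum_single y.1).symm
    rw [hy, map_sum, map_sum]
    exact sum_congr rfl fun i _ => DFunLike.congr_fun (hcomp i) _
  refine (Nat.card_le_card_of_injective res hres).trans (le_of_eq ?_)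
  rw [Nat.card_fun, Nat.card_zmod, Nat.card_eq_fintype_card, Fintype.card_sigma]
  congr 1
  rw [← sum_subtype_eq_sum_filter, subtype_univ]
  exact sum_congr rfl fun i _ => by rw [Fintype.card_coe, hScard, hK]

/-- The homomorphism `(a, b) ↦ b - A a`, whose kernel is the graph of the matrix `A`. -/
def graphHom {p n k : ℕ} (hkn : k ≤ n) (A : Matrix (Fin (n - k)) (Fin k) (ZMod p)) :
    (Fin n → ZMod p) →+ (Fin (n - k) → ZMod p) where
  toFun x j := x ⟨k + j, by omega⟩ - ∑ l, A j l * x (Fin.castLE hkn l)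
  map_zero' := by
    funext j
    simp
  map_add' x y := by
    funext j
    simp only [Pi.add_apply, mul_add, sum_add_distrib]
    ring

lemma graphHom_surjective {p n k : ℕ} (hkn : k ≤ n)
    (A : Matrix (Fin (n - k)) (Fin k) (ZMod p)) : Function.Surjective (graphHom hkn A) := by
  intro y
  refine ⟨fun t => if h : k ≤ t then y ⟨t - k, by omega⟩ else 0, ?_⟩
  funext j
  have h0 : ∀ l : Fin k, ¬ k ≤ (l : ℕ) := fun l => by omega
  simp [graphHom, h0]

lemma rank_ker_graphHom {p n k : ℕ} [Fact p.Prime] (hkn : k ≤ n)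
    (A : Matrix (Fin (n - k)) (Fin k) (ZMod p)) : AddGroup.rank (graphHom hkn A).ker = k := by
  have h1 := AddSubgroup.card_eq_card_quotient_mul_card_addSubgroup (graphHom hkn A).ker
  rw [Nat.card_congr (QuotientAddGroup.quotientKerEquivOfSurjective _
    (graphHom_surjective hkn A)).toEquiv, card_eq_pow_rank] at h1
  simp only [Nat.card_fun, Nat.card_zmod, Nat.card_fin] at h1
  rw [← pow_add] at h1
  have := Nat.pow_right_injective (Fact.out : p.Prime).two_le h1
  omega

lemma ker_graphHom_injective {p n k : ℕ} (hkn : k ≤ n) :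
    Function.Injective fun A : Matrix (Fin (n - k)) (Fin k) (ZMod p) => (graphHom hkn A).ker := by
  classical
  intro A B h
  ext j l
  -- The vector `(e_l, A e_l)` lies in the graph of `A`.
  let x : Fin n → ZMod p := fun t =>
    if h : k ≤ t then A ⟨t - k, by omega⟩ l else if (t : ℕ) = l then 1 else 0
  have hx : ∀ C : Matrix (Fin (n - k)) (Fin k) (ZMod p), ∀ j,
      graphHom hkn C x j = A j l - C j l := by
    intro C j
    have h0 : ∀ l : Fin k, ¬ k ≤ (l : ℕ) := fun l => by omega
    simp [graphHom, x, h0, ← Fin.ext_iff]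
  have hmem : x ∈ (graphHom hkn A).ker := by
    rw [AddMonoidHom.mem_ker]
    funext j
    rw [hx, sub_self]
    rfl
  have h' : (graphHom hkn A).ker = (graphHom hkn B).ker := h
  rw [h', AddMonoidHom.mem_ker] at hmem
  have := congrFun hmem j
  rw [hx] at this
  exact sub_eq_zero.1 this

lemma pi_univ_injective {m : ℕ} {G : Fin m → Type*} [∀ i, AddGroup (G i)] :
    Function.Injective fun K : ∀ i, AddSubgroup (G i) => AddSubgroup.pi Set.univ K := by
  classical
  have key : ∀ K K' : ∀ i, AddSubgroup (G i),
      AddSubgroup.pi Set.univ K ≤ AddSubgroup.pi Set.univ K' → ∀ i, K i ≤ K' i := by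
    intro K K' h i y hy
    have hmem : Pi.single i y ∈ AddSubgroup.pi Set.univ K := by
      rw [AddSubgroup.mem_pi]
      intro j _
      by_cases hj : j = i
      · subst hj
        simpa using hy
      · rw [Pi.single_eq_of_ne hj]
        exact (K j).zero_mem
    simpa using (AddSubgroup.mem_pi _).1 (h hmem) i trivial
  intro K K' h
  funext i
  exact le_antisymm (key K K' (le_of_eq h) i) (key K' K (le_of_eq h.symm) i)

/-! ### The two bounds on the sample complexity -/

/-- The products of graphs of matrices are `∏ p j ^ (k j * (n j - k j)) ≥ N ^ κ` candidates. -/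
lemma lower_bound_rAHSP {m : ℕ} (p n k : Fin m → ℕ) [∀ i, Fact (p i).Prime] (hm : 0 < m)
    (hkn : ∀ i, 0 < k i ∧ k i < n i) {V : Type*} [Finite V]
    (hV : ∏ j, p j ^ (n j - k j) ≤ Nat.card V) {δ : ℝ} (hδ : δ < 1 / 2) {T : ℕ}
    (hT : SolvableWith (rAHSPCandidates p n k) V δ T) {κ : ℕ} (hκ : 0 < κ) (hκk : ∀ i, κ ≤ k i) :
    (κ : ℝ) ≤ T ∧ Real.sqrt (κ * ∏ j, (p j : ℝ) ^ (n j - k j)) ≤ 4 * T := by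
  classical
  obtain ⟨A, hA⟩ := hT
  have hle : ∀ i, k i ≤ n i := fun i => (hkn i).2.le
  let Q := ∀ i, Fin (n i - k i) → ZMod (p i)
  let ι := ∀ i, Matrix (Fin (n i - k i)) (Fin (k i)) (ZMod (p i))
  let H : ι → AddSubgroup (PrimePowerProd p n) := fun B =>
    AddSubgroup.pi Set.univ fun i => (graphHom (hle i) (B i)).ker
  let u : ι → PrimePowerProd p n →+ Q := fun B =>
    { toFun := fun x i => graphHom (hle i) (B i) (x i)
      map_zero' := by
        funext i
        exact map_zero _
      map_add' := fun x y => by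
        funext i
        exact map_add _ _ _ }
  have hQ : Fintype.card Q = ∏ j, p j ^ (n j - k j) := by
    simp [Q, Fintype.card_pi, ZMod.card]
  have hι : Fintype.card ι = ∏ j, p j ^ ((n j - k j) * k j) := by
    have : ∀ i, Fintype.card (Matrix (Fin (n i - k i)) (Fin (k i)) (ZMod (p i)))
        = p i ^ ((n i - k i) * k i) := fun i => by
      change Fintype.card (Fin (n i - k i) → Fin (k i) → ZMod (p i)) = _
      simp [ZMod.card, ← pow_mul, mul_comm]
    rw [Fintype.card_pi]
    exact prod_congr rfl fun i _ => this i
  have hpow : Fintype.card Q ^ κ ≤ Fintype.card ι := by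
    rw [hQ, hι, ← prod_pow]
    refine prod_le_prod' fun i _ => ?_
    rw [← pow_mul]
    exact Nat.pow_le_pow_right (Fact.out : (p i).Prime).pos (Nat.mul_le_mul_left _ (hκk i))
  have hQ2 : 2 ≤ Fintype.card Q := by
    let i₀ : Fin m := ⟨0, hm⟩
    rw [hQ]
    calc 2 ≤ p i₀ := (Fact.out : (p i₀).Prime).two_le
      _ ≤ p i₀ ^ (n i₀ - k i₀) := Nat.le_self_pow (by have := hkn i₀; omega) _
      _ ≤ _ := single_le_prod' (f := fun j => p j ^ (n j - k j))
          (fun j _ => Nat.one_le_pow _ _ (Fact.out : (p j).Prime).pos) (mem_univ i₀)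
  have hinj : Function.Injective H := fun B B' h => by
    funext i
    exact ker_graphHom_injective (hle i) (congrFun (pi_univ_injective h) i)
  have hhides : ∀ B, Hides (u B) (H B) := fun B x y => by
    rw [map_add, left_eq_add, AddSubgroup.mem_pi]
    constructor
    · intro h i _
      exact congrFun h i
    · intro h
      funext i
      exact h i trivial
  have hsurj : ∀ B, Function.Surjective (u B) := fun B y => by
    choose x hx using fun i => graphHom_surjective (hle i) (B i) (y i)
    exact ⟨x, funext hx⟩
  have hmem : ∀ B, H B ∈ rAHSPCandidates p n k := fun B =>
    ⟨_, fun i => rank_ker_graphHom (hle i) (B i), rfl⟩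
  have := Fintype.ofFinite V
  obtain ⟨g⟩ : Nonempty (Q ↪ V) := Function.Embedding.nonempty_of_card_le (by
    rw [hQ, ← Nat.card_eq_fintype_card]
    exact hV)
  have := lower_bound_of_family hκ hQ2 hpow hinj hhides hsurj g hδ fun B f hf =>
    hA (H B) (hmem B) f hf
  rw [hQ] at this
  exact_mod_cast this

lemma sum_filter_eq_le {m μ κ : ℕ} (p k : Fin m → ℕ) (ℓ : ℕ)
    (hμ : ∀ i, (univ.filter fun j => p j = p i).card ≤ μ) (hκ : ∀ i, k i ≤ κ) :
    ∑ i ∈ univ.filter (fun i => p i = ℓ), k i ≤ μ * κ := by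
  calc _ ≤ (univ.filter fun i => p i = ℓ).card * κ := by
        rw [← smul_eq_mul]
        exact sum_le_card_nsmul _ _ _ fun i _ => hκ i
    _ ≤ μ * κ := by
        refine Nat.mul_le_mul_right _ ?_
        by_cases h : ∃ i, p i = ℓ
        · obtain ⟨i, rfl⟩ := h
          exact hμ i
        · rw [filter_false_of_mem fun i _ hi => h ⟨i, hi⟩]
          simp

/-- The collision algorithm succeeds with `2 τ` samples for `τ = ⌈2 (μ + s + 2 + L) B⌉`, which is
large enough both for `2 M ≤ τ` and for `4 N (M + L) ≤ τ ^ 2` with `M = μ * max k i + s + 2`. -/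
lemma upper_bound_rAHSP {m : ℕ} (p n k : Fin m → ℕ) [∀ i, Fact (p i).Prime]
    (hkn : ∀ i, 0 < k i ∧ k i < n i) {μ : ℕ}
    (hμ : ∀ i, (univ.filter fun j => p j = p i).card ≤ μ) (V : Type*) {δ L : ℝ} {s : ℕ}
    (hL : 0 ≤ L) (hδ : Real.exp (-L) + ((2 : ℝ) ^ s)⁻¹ ≤ δ) (i₀ : Fin m)
    (hmax : ∀ i, k i ≤ k i₀) {B : ℝ} (hB : (k i₀ : ℝ) ≤ B)
    (hB' : Real.sqrt ((k i₀ : ℝ) * ∏ j, (p j : ℝ) ^ (n j - k j)) ≤ B) :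
    ∃ T : ℕ, SolvableWith (rAHSPCandidates p n k) V δ T ∧
      (T : ℝ) ≤ (4 * (μ + s + 2 + L) + 2) * B := by
  set κ := k i₀
  set N := ∏ j, p j ^ (n j - k j) with hN
  have hNr : ∏ j, (p j : ℝ) ^ (n j - k j) = N := by
    rw [hN]
    push_cast
    rfl
  have hκ1 : (1 : ℝ) ≤ κ := by exact_mod_cast (hkn i₀).1
  have hBsq : (κ : ℝ) * N ≤ B ^ 2 := by
    rw [hNr] at hB'
    exact (Real.sqrt_le_left (by linarith)).1 hB'
  set a : ℝ := μ + s + 2 + L with ha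
  have ha2 : 2 ≤ a := by
    have h1 : (0 : ℝ) ≤ μ := by positivity
    have h2 : (0 : ℝ) ≤ s := by positivity
    linarith
  have hτ : 2 * a * B ≤ (⌈2 * a * B⌉₊ : ℝ) := Nat.le_ceil _
  have hτ' : (⌈2 * a * B⌉₊ : ℝ) < 2 * a * B + 1 := Nat.ceil_lt_add_one (by nlinarith)
  have hM : ((μ * κ + (s + 2) : ℕ) : ℝ) + L ≤ a * κ := by
    have h2 : (0 : ℝ) ≤ s + 2 + L := by positivity
    push_cast
    nlinarith
  have haB : a * κ ≤ a * B := mul_le_mul_of_nonneg_left hB (by linarith)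
  refine ⟨⌈2 * a * B⌉₊ + ⌈2 * a * B⌉₊,
    solvableWith_of_bounds (d := μ * κ) (s := s) (N := N) (L := L)
    (fun H hH ℓ hℓ => (card_hom_le_of_mem_candidates hH hℓ).trans
      (Nat.pow_le_pow_right hℓ.pos (sum_filter_eq_le p k ℓ hμ hmax)))
    (fun H hH => card_quotient_of_mem_candidates (fun i => (hkn i).2.le) hH) ?_ ?_ hδ, ?_⟩
  · have : (2 : ℝ) * ((μ * κ + (s + 2) : ℕ) : ℝ) ≤ (⌈2 * a * B⌉₊ : ℝ) := by nlinarith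
    exact_mod_cast this
  · have h1 : (2 * a * B) ^ 2 ≤ (⌈2 * a * B⌉₊ : ℝ) ^ 2 :=
      pow_le_pow_left₀ (by nlinarith) hτ 2
    refine le_trans ?_ h1
    have hN0 : (0 : ℝ) ≤ N := by positivity
    calc 4 * (N : ℝ) * (((μ * κ + (s + 2) : ℕ) : ℝ) + L) ≤ 4 * N * (a * κ) := by gcongr
      _ = 4 * a * (κ * N) := by ring
      _ ≤ 4 * a * B ^ 2 := by gcongr
      _ ≤ 4 * a * B ^ 2 * a := le_mul_of_one_le_right (by positivity) (by linarith)
      _ = _ := by ring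
  · push_cast
    nlinarith

end HiddenSubgroup

theorem corollary2 :
    (∃ c : ℝ, 0 < c ∧
      ∀ δ : ℝ, 0 ≤ δ → δ < 1 / 2 →
      ∀ (m : ℕ) (p n k : Fin m → ℕ) [∀ i, Fact (p i).Prime],
        0 < m → (∀ i, 0 < k i ∧ k i < n i) →
      ∀ (V : Type*) [Finite V], ∏ j, p j ^ (n j - k j) ≤ Nat.card V →
        ENNReal.ofReal (c * max (⨅ i, (k i : ℝ))
            (⨅ i, Real.sqrt ((k i : ℝ) * ∏ j, (p j : ℝ) ^ (n j - k j))))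
          ≤ (HiddenSubgroup.sampleComplexity
              (HiddenSubgroup.rAHSPCandidates p n k) V δ : ℝ≥0∞)) ∧
    (∀ δ : ℝ, 0 < δ → δ < 1 / 2 → ∀ μ : ℕ,
      ∃ C : ℝ, 0 < C ∧
      ∀ (m : ℕ) (p n k : Fin m → ℕ) [∀ i, Fact (p i).Prime],
        0 < m → (∀ i, 0 < k i ∧ k i < n i) →
        (∀ i, (Finset.univ.filter fun j => p j = p i).card ≤ μ) →
      ∀ (V : Type*) [Finite V],
        (HiddenSubgroup.sampleComplexity
              (HiddenSubgroup.rAHSPCandidates p n k) V δ : ℝ≥0∞)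
          ≤ ENNReal.ofReal (C * ⨆ i, max (k i : ℝ)
              (Real.sqrt ((k i : ℝ) * ∏ j, (p j : ℝ) ^ (n j - k j))))) := by
  constructor
  · refine ⟨1 / 4, by norm_num, ?_⟩
    intro δ _ hδ m p n k _ hm hkn V _ hV
    have : Nonempty (Fin m) := ⟨⟨0, hm⟩⟩
    obtain ⟨i₀, hi₀⟩ := Finite.exists_min k
    set r := max (⨅ i, (k i : ℝ))
      (⨅ i, Real.sqrt ((k i : ℝ) * ∏ j, (p j : ℝ) ^ (n j - k j))) with hr
    have hceil : ((⌈1 / 4 * r⌉₊ : ℕ) : ℕ∞) ≤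
        HiddenSubgroup.sampleComplexity (HiddenSubgroup.rAHSPCandidates p n k) V δ := by
      refine le_iInf fun T => le_iInf fun hT => ?_
      obtain ⟨h1, h2⟩ := HiddenSubgroup.lower_bound_rAHSP p n k hm hkn hV hδ hT
        (hkn i₀).1 hi₀
      refine Nat.cast_le.2 (Nat.ceil_le.2 ?_)
      have hT0 : (0 : ℝ) ≤ T := Nat.cast_nonneg T
      have h3 : r ≤ 4 * T := by
        refine max_le ?_ ?_
        · refine (ciInf_le (Finite.bddBelow_range _) i₀).trans ?_
          linarith
        · exact (ciInf_le (Finite.bddBelow_range _) i₀).trans h2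
      linarith
    calc ENNReal.ofReal (1 / 4 * r) ≤ ENNReal.ofReal ((⌈1 / 4 * r⌉₊ : ℕ) : ℝ) :=
          ENNReal.ofReal_le_ofReal (Nat.le_ceil _)
      _ = (((⌈1 / 4 * r⌉₊ : ℕ) : ℕ∞) : ℝ≥0∞) := by simp
      _ ≤ _ := ENat.toENNReal_le.2 hceil
  · intro δ hδ hδ' μ
    obtain ⟨s, hs⟩ := exists_pow_lt_of_lt_one (half_pos hδ) (by norm_num : (1 / 2 : ℝ) < 1)
    have hL : 0 ≤ -Real.log (δ / 2) :=
      neg_nonneg.2 (Real.log_nonpos (by linarith) (by linarith))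
    have herr : Real.exp (-(-Real.log (δ / 2))) + ((2 : ℝ) ^ s)⁻¹ ≤ δ := by
      rw [neg_neg, Real.exp_log (half_pos hδ), ← inv_pow, ← one_div]
      linarith
    refine ⟨4 * (μ + s + 2 + -Real.log (δ / 2)) + 2, by positivity, ?_⟩
    intro m p n k _ hm hkn hμ V _
    have : Nonempty (Fin m) := ⟨⟨0, hm⟩⟩
    obtain ⟨i₀, hi₀⟩ := Finite.exists_max k
    have hB := le_ciSup (Finite.bddAbove_range fun i => max (k i : ℝ)
      (Real.sqrt ((k i : ℝ) * ∏ j, (p j : ℝ) ^ (n j - k j)))) i₀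
    obtain ⟨T, hT, hTle⟩ := HiddenSubgroup.upper_bound_rAHSP p n k hkn hμ V hL herr
      i₀ hi₀ ((le_max_left _ _).trans hB) ((le_max_right _ _).trans hB)
    have h1 : HiddenSubgroup.sampleComplexity (HiddenSubgroup.rAHSPCandidates p n k) V δ ≤
        (T : ℕ∞) :=
      iInf_le_of_le T (iInf_le _ hT)
    calc _ ≤ ((T : ℕ∞) : ℝ≥0∞) := ENat.toENNReal_le.2 h1
      _ = ENNReal.ofReal (T : ℝ) := by simp
      _ ≤ _ := ENNReal.ofReal_le_ofReal hTle
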